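/- Let $\mathcal M=(S,Act,\mathbf P,s_I,\rho)$ be a Markov decision process: $S$ and $Act$ are finite, $s_I\in S$, $\mathbf P\colon S\times Act\times S\to[0,1]$ with $\sum_{s'}\mathbf P(s,\alpha,s')\in\{0,1\}$, $\rho\colon S\times Act\to\mathbb R$ is a reward function (which plays no role here), and $Act(s)=\{\alpha\mid\sum_{s'}\mathbf P(s,\alpha,s')=1\}\neq\emptyset$ for every $s\in S$. Let $G\subseteq S$ be a set of absorbing states, i.e. $\mathbf P(s,\alpha,s)=1$ for all $s\in G$, $\alpha\in Act(s)$. A (deterministic, history dependent) scheduler $\sigma$ maps each finite path to an action enabled in its last state; $\mathrm{Pr}^\sigma_s$ is the induced probability measure on the infinite paths from $s$, $\lozenge T$ is the set of paths that visit $T\subseteq S$, $\mathrm{Pr}^{\max}_s(\lozenge G)=\max_\sigma\mathrm{Pr}^\sigma_s(\lozenge G)$, and $\mathrm{Pr}^{\max}(\lozenge G)=\mathrm{Pr}^{\max}_{s_I}(\lozenge G)$. Let $S_0=\{s\mid\mathrm{Pr}^{\max}_s(\lozenge G)=0\}$ and $S_?=S\setminus(S_0\cup G)$. Assume that $\mathcal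 M$ is contracting with respect to $G\cup S_0$, i.e. $\mathrm{Pr}^\sigma_s(\lozenge(G\cup S_0))=1$ for all $s\in S$ and all schedulers $\sigma$, and let $\varepsilon>0$. Consider the following algorithm (sound value iteration for MDPs), with exact real arithmetic for the vectors and extended real values for the bounds. Start with $x_0=1$ on $G$ and $0$ elsewhere, $y_0=1$ on $S_?$ and $0$ elsewhere, $\ell_0=-\infty$, $u_0=+\infty$, $d_0=-\infty$. For $k=1,2,\dots$ do: 1. For each $s\in S_?$ let $\alpha_s$ be the result of $\mathit{findAction}(x_{k-1},y_{k-1},s,u_{k-1})$. 2. Set $x_k[s]=\sum_{s'}\mathbf P(s,\alpha_s,s')\,x_{k-1}[s']$ and $y_k[s]=\sum_{s'}\mathbf P(s,\alpha_s,s')\,y_{k-1}[s']$ for $s\in S_?$, with $x_k=1$ on $G$, $x_k=0$ on $S_0$, and $y_k=0$ on $S\setminus S_?$. 3. Set $d_k=\max\bigl(d_{k-1},\max_{s\in S_?}\mathit{decisionValue}(x_{k-1},y_{k-1},s,\alpha_s)\bigr)$. 4. If $y_k[s]<1$ for all $s\in S_?$, set $\ell_k=\max\bigl(\ell_{k-1},\min_{s\in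 S_?}\frac{x_k[s]}{1-y_k[s]}\bigr)$ and $u_k=\min\bigl(u_{k-1},\max(d_k,\max_{s\in S_?}\frac{x_k[s]}{1-y_k[s]})\bigr)$; otherwise $\ell_k=\ell_{k-1}$ and $u_k=u_{k-1}$. 5. If $y_k[s_I]\cdot(u_k-\ell_k)<2\varepsilon$, stop and return $r=x_k[s_I]+y_k[s_I]\cdot\frac{\ell_k+u_k}{2}$. Here products with the factor $0$ are $0$, even if the other factor is infinite or is the undefined expression $-\infty+\infty$; the minimum of the empty set is $+\infty$ and its maximum $-\infty$. The function $\mathit{findAction}(x,y,s,u)$ returns, for real $u$, an arbitrary maximizer over $\alpha\in Act(s)$ of $\sum_{s'}\mathbf P(s,\alpha,s')\,(x[s']+y[s']\,u)$; for $u=+\infty$ it returns an action that maximizes this expression for all sufficiently large real $u$, that is, a maximizer of $\sum_{s'}\mathbf P(s,\alpha,s')\,y[s']$ which, among these maximizers, maximizes $\sum_{s'}\mathbf P(s,\alpha,s')\,x[s']$. The value $\mathit{decisionValue}(x,y,s,\alpha)$ is the maximum of $$\frac{\sum_{s'}(\mathbf P(s,\beta,s')-\mathbf P(s,\alpha,s'))\,x[s']}{\sum_{s'}(\mathbf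 P(s,\alpha,s')-\mathbf P(s,\beta,s'))\,y[s']}$$ over all $\beta\in Act(s)\setminus\{\alpha\}$ with positive denominator, and $-\infty$ if there is no such $\beta$. Then, however $\mathit{findAction}$ resolves its remaining choices, the algorithm terminates, and the returned value $r$ is a real number with $|r-\mathrm{Pr}^{\max}(\lozenge G)|\le\varepsilon$. -/

import Mathlib

open MeasureTheory ProbabilityTheory

/-- A Markov decision process with (finite) state space `S` and action set `A`. -/
structure MDP (S A : Type*) [Fintype S] where
  /-- the transition probabilities `P(s, α, s')` -/
  P : S → A → S → ℝ
  /-- the initial state -/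
  init : S
  /-- the reward function -/
  reward : S → A → ℝ
  P_nonneg : ∀ s a s', 0 ≤ P s a s'
  P_sum : ∀ s a, ∑ s', P s a s' = 0 ∨ ∑ s', P s a s' = 1
  exists_enabled : ∀ s, ∃ a, ∑ s', P s a s' = 1

namespace MDP

/-! ### Paths, schedulers, reachability probabilities -/

section Model

variable {S A : Type*} [Fintype S] (M : MDP S A)

/-- The set `Act(s)` of actions that are enabled in the state `s`. -/
def Act (s : S) : Set A := {a | ∑ s', M.P s a s' = 1}

/-- All enabled actions loop with probability one. -/
def IsAbsorbing (s : S) : Prop := ∀ a ∈ M.Act s, M.P s a s = 1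

/-- A state together with an action that is enabled there. An infinite path `s₀ α₀ s₁ α₁ …` is a
sequence `ℕ → M.Move`. (Sequences with a transition of probability zero are not excluded here;
they form a null set for each of the path measures below.) -/
def Move : Type _ := {p : S × A // p.2 ∈ M.Act p.1}

/-- The state component `s` of `(s, α)`. -/
def Move.state {M : MDP S A} (p : M.Move) : S := p.1.1

/-- The action component `α` of `(s, α)`. -/
def Move.action {M : MDP S A} (p : M.Move) : A := p.1.2

instance : MeasurableSpace M.Move := ⊤

instance : DiscreteMeasurableSpace M.Move := ⟨fun _ => trivial⟩

instance [Finite A] : Finite M.Move := by unfold Move; infer_instance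

/-- A deterministic (history dependent) scheduler. The finite path `s₀ α₀ … αₙ₋₁ sₙ` is given by
the list `[(s₀, α₀), …, (sₙ₋₁, αₙ₋₁)]` and its last state `sₙ`. -/
structure Scheduler where
  act : List M.Move → S → A
  enabled : ∀ h s, act h s ∈ M.Act s

variable {M}

/-- The state `s`, reached with the past `h`, together with the action that `σ` selects there. -/
def Scheduler.move (σ : M.Scheduler) (h : List M.Move) (s : S) : M.Move :=
  ⟨(s, σ.act h s), σ.enabled h s⟩

/-- The distribution of the next state (with the action selected there) if `(s, α) = p` is the
last entry of the past `h`: the state `s'` has probability `P(s, α, s')`. -/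
noncomputable def Scheduler.next (σ : M.Scheduler) (h : List M.Move) (p : M.Move) :
    Measure M.Move :=
  ∑ s', ENNReal.ofReal (M.P p.state p.action s') • Measure.dirac (σ.move h s')

instance (σ : M.Scheduler) (h : List M.Move) (p : M.Move) :
    IsProbabilityMeasure (σ.next h p) := by
  constructor
  have hp : ∑ s', M.P p.state p.action s' = 1 := p.2
  simp only [Scheduler.next, Measure.coe_finsetSum, Measure.coe_smul, Finset.sum_apply,
    Pi.smul_apply, measure_univ, smul_eq_mul, mul_one]
  rw [← ENNReal.ofReal_sum_of_nonneg fun s' _ => M.P_nonneg _ _ _, hp, ENNReal.ofReal_one]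

/-- The first `n + 1` entries of a path, as a list. -/
def pastList (n : ℕ) (w : Finset.Iic n → M.Move) : List M.Move :=
  List.ofFn fun i : Fin (n + 1) => w ⟨i, Finset.mem_Iic.2 (Nat.lt_succ_iff.1 i.2)⟩

/-- The transition kernel from the first `n + 1` entries of a path to the next one. -/
noncomputable def Scheduler.kernel [Finite A] (σ : M.Scheduler) (n : ℕ) :
    Kernel (Finset.Iic n → M.Move) M.Move :=
  Kernel.ofFunOfCountable fun w =>
    σ.next (pastList n w) (w ⟨n, Finset.mem_Iic.2 le_rfl⟩)

instance [Finite A] (σ : M.Scheduler) (n : ℕ) : IsMarkovKernel (σ.kernel n) :=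
  ⟨fun w => by
    change IsProbabilityMeasure (σ.next _ _)
    infer_instance⟩

/-- The probability measure on infinite paths that start in `s`, under the scheduler `σ`. -/
noncomputable def Scheduler.pathMeasure [Finite A] (σ : M.Scheduler) (s : S) :
    Measure (ℕ → M.Move) :=
  Kernel.traj (X := fun _ => M.Move) σ.kernel 0 (fun _ => σ.move [] s)

variable (M)

/-- The set `◇ G` of the infinite paths that visit `G`. -/
def reach (G : Set S) : Set (ℕ → M.Move) := {w | ∃ j, (w j).state ∈ G}

/-- The reachability probability of `G` from `s` under `σ`. -/
noncomputable def reachProb [Finite A] (σ : M.Scheduler) (s : S) (G : Set S) : ℝ :=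
  (σ.pathMeasure s).real (M.reach G)

/-- The maximal reachability probability of `G` from `s`. -/
noncomputable def maxReachProb [Finite A] (s : S) (G : Set S) : ℝ :=
  ⨆ σ : M.Scheduler, M.reachProb σ s G

/-- `M` is contracting with respect to `T`. -/
def IsContracting [Finite A] (T : Set S) : Prop :=
  ∀ (s : S) (σ : M.Scheduler), M.reachProb σ s T = 1

/-- The set `S₀` of the states from which `G` is reached with maximal probability zero. -/
def zeroStates [Finite A] (G : Set S) : Set S := {s | M.maxReachProb s G = 0}

end Model

/-! ### Sound value iteration for MDPs -/

/-- The maximizers of `f` on `T`. -/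
def argmax {A : Type*} (T : Set A) (f : A → ℝ) : Set A := {a | a ∈ T ∧ ∀ b ∈ T, f b ≤ f a}

/-- The values of the program variables `x_k, y_k, ℓ_k, u_k, d_k`. -/
structure Vars (S : Type*) where
  x : S → ℝ
  y : S → ℝ
  l : EReal
  u : EReal
  d : EReal

/-- A configuration of the program: at the head of the loop, or stopped with a returned value. -/
inductive Config (S : Type*) where
  | running (c : Vars S)
  | returned (r : EReal)

section Algorithm

variable {S A : Type*} [Fintype S] [Fintype A] (M : MDP S A) (G : Set S)

/-- `∑_{s'} P(s, α, s') · z[s']` -/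
def expect (s : S) (a : A) (z : S → ℝ) : ℝ := ∑ s', M.P s a s' * z s'

open Classical in
/-- The actions that `findAction(x, y, s, u)` may return. For a real number `u` these are the
maximizers of `∑_{s'} P(s, α, s') · (x[s'] + y[s'] · u)`. The value `u = ∞` stands for a
sufficiently large real number: one maximizes `∑_{s'} P(s, α, s') · y[s']`, and among the
maximizers `∑_{s'} P(s, α, s') · x[s']`. -/
noncomputable def findAction (x y : S → ℝ) (s : S) (u : EReal) : Set A :=
  if u ≠ ⊤ then argmax (M.Act s) fun a => M.expect s a fun s' => x s' + y s' * u.toReal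
  else argmax (argmax (M.Act s) fun a => M.expect s a y) fun a => M.expect s a x

/-- The case `u = ∞` of `findAction` agrees with the real case for all sufficiently large `u`. -/
theorem mem_findAction_top_iff (x y : S → ℝ) (s : S) (a : A) :
    a ∈ M.findAction x y s ⊤ ↔ ∀ᶠ v : ℝ in Filter.atTop, a ∈ M.findAction x y s (v : EReal) := by
  have key : ∀ (b : A) (v : ℝ), M.expect s b (fun s' => x s' + y s' * v) =
      M.expect s b x + M.expect s b y * v := fun b v => by
    simp only [expect, mul_add, Finset.sum_add_distrib, Finset.sum_mul, mul_assoc]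
  simp only [findAction, ne_eq, EReal.coe_ne_top, not_false_eq_true, if_true, not_true_eq_false,
    if_false, EReal.toReal_coe, argmax, Set.mem_ofPred_eq, key]
  constructor
  · rintro ⟨⟨ha, hy⟩, hx⟩
    have : ∀ b : A, ∀ᶠ v : ℝ in Filter.atTop, b ∈ M.Act s →
        M.expect s b x + M.expect s b y * v ≤ M.expect s a x + M.expect s a y * v := by
      intro b
      by_cases hb : b ∈ M.Act s
      · rcases (hy b hb).lt_or_eq with h | h
        · have hpos : 0 < M.expect s a y - M.expect s b y := by linarith
          filter_upwards [Filter.eventually_ge_atTop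
            ((M.expect s b x - M.expect s a x) / (M.expect s a y - M.expect s b y))] with v hv _
          rw [div_le_iff₀ hpos] at hv
          linarith
        · refine Filter.Eventually.of_forall fun v _ => ?_
          have := hx b ⟨hb, fun c hc => by rw [h]; exact hy c hc⟩
          rw [h]; linarith
      · exact Filter.Eventually.of_forall fun v h => absurd h hb
    filter_upwards [Filter.eventually_all.2 this] with v hv
    exact ⟨ha, hv⟩
  · intro h
    obtain ⟨v₀, hv₀⟩ := Filter.eventually_atTop.1 h
    have ha := (hv₀ v₀ le_rfl).1
    have hy : ∀ b ∈ M.Act s, M.expect s b y ≤ M.expect s a y := by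
      intro b hb
      by_contra! hlt
      have hpos : 0 < M.expect s b y - M.expect s a y := by linarith
      obtain ⟨v, hv, hv'⟩ : ∃ v : ℝ, v₀ ≤ v ∧
          (M.expect s a x - M.expect s b x) / (M.expect s b y - M.expect s a y) < v :=
        ⟨max v₀ ((M.expect s a x - M.expect s b x) / (M.expect s b y - M.expect s a y) + 1),
          le_max_left _ _, lt_of_lt_of_le (by linarith) (le_max_right _ _)⟩
      rw [div_lt_iff₀ hpos] at hv'
      have := (hv₀ v hv).2 b hb
      linarith
    refine ⟨⟨ha, hy⟩, fun b ⟨hb, hb'⟩ => ?_⟩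
    have := (hv₀ v₀ le_rfl).2 b hb
    have h1 := le_antisymm (hy b hb) (hb' a ha)
    rw [h1] at this
    linarith

open Classical in
/-- `decisionValue(x, y, s, α)`; the supremum over the empty set is `-∞`. -/
noncomputable def decisionValue (x y : S → ℝ) (s : S) (a : A) : EReal :=
  (Finset.univ.filter fun b : A =>
      b ∈ M.Act s ∧ b ≠ a ∧ 0 < ∑ s', (M.P s a s' - M.P s b s') * y s').sup fun b =>
    (((∑ s', (M.P s b s' - M.P s a s') * x s') /
      (∑ s', (M.P s a s' - M.P s b s') * y s') : ℝ) : EReal)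

open Classical in
/-- The set `S_? = S \ (S₀ ∪ G)`. -/
noncomputable def unknownStates : Finset S :=
  Finset.univ.filter fun s => s ∉ M.zeroStates G ∪ G

open Classical in
/-- The values of the variables before the first iteration. -/
noncomputable def initVars : Vars S where
  x s := if s ∈ G then 1 else 0
  y s := if s ∈ M.unknownStates G then 1 else 0
  l := ⊥
  u := ⊤
  d := ⊥

open Classical in
/-- The vector `x_k` if `α s` is the action found for `s ∈ S_?`. -/
noncomputable def updateX (x : S → ℝ) (α : S → A) (s : S) : ℝ :=
  if s ∈ G then 1 else if s ∈ M.unknownStates G then M.expect s (α s) x else 0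

open Classical in
/-- The vector `y_k` if `α s` is the action found for `s ∈ S_?`. -/
noncomputable def updateY (y : S → ℝ) (α : S → A) (s : S) : ℝ :=
  if s ∈ M.unknownStates G then M.expect s (α s) y else 0

/-- The decision value `d_k` if `α s` is the action found for `s ∈ S_?`. -/
noncomputable def updateD (c : Vars S) (α : S → A) : EReal :=
  max c.d ((M.unknownStates G).sup fun s => M.decisionValue c.x c.y s (α s))

open Classical in
/-- The effect of one iteration of the loop on the variables if `α s` is the action found for
`s ∈ S_?`. The bounds `ℓ` and `u` keep their values if the condition of the if-statement fails. -/
noncomputable def iterate (c : Vars S) (α : S → A) : Vars S :=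
  let x' := M.updateX G c.x α
  let y' := M.updateY G c.y α
  let d' := M.updateD G c α
  let ratio : S → EReal := fun s => ((x' s / (1 - y' s) : ℝ) : EReal)
  if ∀ s ∈ M.unknownStates G, y' s < 1 then
    { x := x', y := y', d := d'
      l := max c.l ((M.unknownStates G).inf ratio)
      u := min c.u (max d' ((M.unknownStates G).sup ratio)) }
  else { x := x', y := y', d := d', l := c.l, u := c.u }

/-- `c'` may result from `c` by one iteration of the loop. -/
def Body (c c' : Vars S) : Prop :=
  ∃ α : S → A, (∀ s ∈ M.unknownStates G, α s ∈ M.findAction c.x c.y s c.u) ∧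
    c' = M.iterate G c α

/-- The exit condition `y_k[s_I] · (u_k - ℓ_k) < 2 · ε` of the loop. -/
def ExitCond (ε : ℝ) (c : Vars S) : Prop :=
  (c.y M.init : EReal) * (c.u - c.l) < ((2 * ε : ℝ) : EReal)

/-- The value `x_k[s_I] + y_k[s_I] · (ℓ_k + u_k) / 2`. -/
noncomputable def output (c : Vars S) : EReal :=
  (c.x M.init : EReal) + (c.y M.init : EReal) * ((c.l + c.u) / 2)

/-- One pass through the repeat-until loop, with the test at its end; the value is returned when
the loop is left. -/
inductive Step (ε : ℝ) : Config S → Config S → Prop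
  | loop (c c' : Vars S) : M.Body G c c' → ¬ M.ExitCond ε c' →
      Step ε (Config.running c) (Config.running c')
  | exit (c c' : Vars S) : M.Body G c c' → M.ExitCond ε c' →
      Step ε (Config.running c) (Config.returned (M.output c'))

end Algorithm

end MDP

/-!
Under the actions chosen in `k` iterations, `x k s + y k s * v` is the expected value of `k` steps
from `s` that pay `1` on reaching `G` and `v` for still being in `S_?`. It is at most the maximum
`H k v s` over all ways to choose actions, and for `v ∈ [d k, u k]` it equals this maximum: the
actions are optimal for the final value `u k`, and the decision values mark the points below which
another action may overtake.

The maximal reachability probability `V` is a fixed point of the Bellman operator, so a constant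
below (above) `V` on `S_?` yields `H k v` below (above) `V`. Conversely, `v ≤ H k v` on `S_?`
implies `v ≤ V` on `S_?`: iterating the inequality, the difference is damped by the maximal
probability to stay in `S_?`, which tends to `0` because `M` is contracting. For the smallest
quotient `v` of `x k s / (1 - y k s)` this gives the lower bound `l k ≤ V`. Dually, if
`v = V t` is the maximum of `V` on `S_?` and `d k ≤ v`, then `v ≤ x k t + y k t * v`, so that `v`
is at most the largest quotient; hence `V ≤ u k`. Then `V s_I` lies between
`x k s_I + y k s_I * l k` and `x k s_I + y k s_I * u k`, an interval of length below `2 ε` on exit,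
and the loop ends since `y k` is dominated by the probability to stay in `S_?`.
-/

namespace MDP

open Filter Topology
open scoped ENNReal

section Expect

variable {S A : Type*} [Fintype S] (M : MDP S A) {s : S} {a : A} {f g : S → ℝ}

theorem expect_mono (h : f ≤ g) : M.expect s a f ≤ M.expect s a g :=
  Finset.sum_le_sum fun s' _ => mul_le_mul_of_nonneg_left (h s') (M.P_nonneg _ _ _)

theorem expect_nonneg (h : 0 ≤ f) : 0 ≤ M.expect s a f :=
  Finset.sum_nonneg fun s' _ => mul_nonneg (M.P_nonneg _ _ _) (h s')

theorem expect_add_mul (s : S) (a : A) (f g : S → ℝ) (c : ℝ) :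
    M.expect s a (fun s' => f s' + g s' * c) = M.expect s a f + M.expect s a g * c := by
  simp only [expect, mul_add, Finset.sum_add_distrib, Finset.sum_mul, mul_assoc]

theorem expect_const (ha : a ∈ M.Act s) (c : ℝ) : M.expect s a (fun _ => c) = c := by
  have h : ∑ s', M.P s a s' = 1 := ha
  rw [expect, ← Finset.sum_mul, h, one_mul]

theorem sum_ofReal_P (ha : a ∈ M.Act s) : ∑ s', ENNReal.ofReal (M.P s a s') = 1 := by
  have h : ∑ s', M.P s a s' = 1 := ha
  rw [← ENNReal.ofReal_sum_of_nonneg fun s' _ => M.P_nonneg _ _ _, h, ENNReal.ofReal_one]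

theorem sum_ofReal_P_mul_ofReal (s : S) (a : A) (hf : 0 ≤ f) :
    ∑ s', ENNReal.ofReal (M.P s a s') * ENNReal.ofReal (f s') =
      ENNReal.ofReal (M.expect s a f) := by
  rw [expect, ENNReal.ofReal_sum_of_nonneg fun s' _ => mul_nonneg (M.P_nonneg _ _ _) (hf _)]
  exact Finset.sum_congr rfl fun s' _ => (ENNReal.ofReal_mul (M.P_nonneg _ _ _)).symm

end Expect

section Paths

variable {S A : Type*} [Fintype S] {M : MDP S A}

theorem Scheduler.state_move (σ : M.Scheduler) (h : List M.Move) (s : S) :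
    (σ.move h s).state = s := rfl

theorem Scheduler.action_move (σ : M.Scheduler) (h : List M.Move) (s : S) :
    (σ.move h s).action = σ.act h s := rfl

/-- The first `n` entries of a path, as a list: the past that a scheduler sees at time `n`. -/
def history (n : ℕ) (w : ℕ → M.Move) : List M.Move := List.ofFn fun i : Fin n => w i

theorem history_succ (n : ℕ) (w : ℕ → M.Move) : history (n + 1) w = history n w ++ [w n] :=
  List.ofFn_succ_last

theorem length_history (n : ℕ) (w : ℕ → M.Move) : (history n w).length = n :=
  List.length_ofFn

theorem exists_mem_history_state_mem {n : ℕ} {w : ℕ → M.Move} {T : Set S} :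
    (∃ q ∈ history n w, q.state ∈ T) ↔ ∃ j < n, (w j).state ∈ T := by
  simp [history, List.mem_ofFn, Fin.exists_iff]

/-- The backward operator of the Markov chain of pairs (past, current move) under `σ`:
the conditional expectation of `F` one step ahead if the past is `h` and the current move `p`. -/
noncomputable def Scheduler.expectNext (σ : M.Scheduler) (F : List M.Move → M.Move → ℝ≥0∞)
    (h : List M.Move) (p : M.Move) : ℝ≥0∞ :=
  ∑ s', ENNReal.ofReal (M.P p.state p.action s') * F (h ++ [p]) (σ.move (h ++ [p]) s')

theorem Scheduler.lintegral_next (σ : M.Scheduler) (h : List M.Move) (p : M.Move)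
    (f : M.Move → ℝ≥0∞) :
    ∫⁻ q, f q ∂σ.next h p =
      ∑ s', ENNReal.ofReal (M.P p.state p.action s') * f (σ.move h s') := by
  simp only [Scheduler.next, lintegral_finsetSum_measure, lintegral_smul_measure,
    lintegral_dirac, smul_eq_mul]

theorem Scheduler.expectNext_mono (σ : M.Scheduler) {F F' : List M.Move → M.Move → ℝ≥0∞}
    (hF : ∀ h s, F h (σ.move h s) ≤ F' h (σ.move h s)) (h : List M.Move) (p : M.Move) :
    σ.expectNext F h p ≤ σ.expectNext F' h p :=
  Finset.sum_le_sum fun _ _ => mul_le_mul_right (hF _ _) _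

theorem Scheduler.iterate_expectNext_le {σ : M.Scheduler} {F : List M.Move → M.Move → ℝ≥0∞}
    (hF : ∀ h s, σ.expectNext F h (σ.move h s) ≤ F h (σ.move h s)) (n : ℕ) (h : List M.Move)
    (s : S) : σ.expectNext^[n] F h (σ.move h s) ≤ F h (σ.move h s) := by
  induction n generalizing h s with
  | zero => exact le_rfl
  | succ n ih =>
    rw [Function.iterate_succ_apply']
    exact (σ.expectNext_mono ih _ _).trans (hF h s)

theorem Scheduler.le_iterate_expectNext {σ : M.Scheduler} {F : List M.Move → M.Move → ℝ≥0∞}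
    (hF : ∀ h s, F h (σ.move h s) ≤ σ.expectNext F h (σ.move h s)) (n : ℕ) (h : List M.Move)
    (s : S) : F h (σ.move h s) ≤ σ.expectNext^[n] F h (σ.move h s) := by
  induction n generalizing h s with
  | zero => exact le_rfl
  | succ n ih =>
    rw [Function.iterate_succ_apply']
    exact (hF h s).trans (σ.expectNext_mono ih _ _)

variable [Finite A]

instance (σ : M.Scheduler) (s : S) : IsProbabilityMeasure (σ.pathMeasure s) := by
  unfold Scheduler.pathMeasure
  infer_instance

theorem lintegral_pathMeasure_zero (σ : M.Scheduler) (s : S) (f : M.Move → ℝ≥0∞) :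
    ∫⁻ w, f (w 0) ∂σ.pathMeasure s = f (σ.move [] s) := by
  let f₀ : (Finset.Iic 0 → M.Move) → ℝ≥0∞ := fun q => f (q ⟨0, Finset.mem_Iic.2 le_rfl⟩)
  calc ∫⁻ w, f (w 0) ∂σ.pathMeasure s
      = ∫⁻ q, f₀ q ∂(σ.pathMeasure s).map (Preorder.frestrictLe (π := fun _ => M.Move) 0) :=
        (lintegral_map (measurable_of_countable f₀)
          (Preorder.measurable_frestrictLe (X := fun _ => M.Move) 0)).symm
    _ = f (σ.move [] s) := by
        rw [Scheduler.pathMeasure, Kernel.traj_map_frestrictLe_apply, Kernel.partialTraj_self,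
          Kernel.id_apply, lintegral_dirac]

theorem lintegral_pathMeasure_succ (σ : M.Scheduler) (s : S) (n : ℕ)
    (F : List M.Move → M.Move → ℝ≥0∞) :
    ∫⁻ w, F (history (n + 1) w) (w (n + 1)) ∂σ.pathMeasure s =
      ∫⁻ w, σ.expectNext F (history n w) (w n) ∂σ.pathMeasure s := by
  let restrict : (ℕ → M.Move) → Finset.Iic n → M.Move :=
    Preorder.frestrictLe (π := fun _ => M.Move) n
  have hr : Measurable restrict := Preorder.measurable_frestrictLe n
  let f : (Finset.Iic n → M.Move) × M.Move → ℝ≥0∞ := fun q => F (pastList n q.1) q.2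
  calc ∫⁻ w, F (history (n + 1) w) (w (n + 1)) ∂σ.pathMeasure s
      = ∫⁻ q, f q ∂(σ.pathMeasure s).map fun w => (restrict w, w (n + 1)) :=
        (lintegral_map (measurable_of_countable f) (hr.prodMk (measurable_pi_apply _))).symm
    _ = ∫⁻ r, ∫⁻ p, f (r, p) ∂σ.kernel n r ∂(σ.pathMeasure s).map restrict := by
        rw [Scheduler.pathMeasure, Kernel.traj_map_frestrictLe_apply,
          ← Measure.lintegral_compProd (measurable_of_countable f)]
        congr 1
        exact (Kernel.partialTraj_compProd_eq_map_traj (Nat.zero_le n)).symm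
    _ = ∫⁻ w, ∫⁻ p, f (restrict w, p) ∂σ.kernel n (restrict w) ∂σ.pathMeasure s :=
        lintegral_map (measurable_of_countable _) hr
    _ = ∫⁻ w, σ.expectNext F (history n w) (w n) ∂σ.pathMeasure s := by
        refine lintegral_congr fun w => ?_
        rw [Scheduler.expectNext, ← history_succ]
        exact σ.lintegral_next _ _ _

theorem lintegral_history (σ : M.Scheduler) (s : S) (n : ℕ) (F : List M.Move → M.Move → ℝ≥0∞) :
    ∫⁻ w, F (history n w) (w n) ∂σ.pathMeasure s = σ.expectNext^[n] F [] (σ.move [] s) := by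
  induction n generalizing F with
  | zero => exact lintegral_pathMeasure_zero σ s (F [])
  | succ n ih => rw [lintegral_pathMeasure_succ, ih, Function.iterate_succ_apply]

end Paths

section Reach

variable {S A : Type*} [Fintype S] {M : MDP S A} {T : Set S}

open Classical in
/-- The process `v n sₙ` along a path `s₀ α₀ s₁ α₁ …`, replaced by the constant `1` after the
first visit of `T`. Its expectation is compared with the probability of such a visit. -/
noncomputable def stoppedAt (T : Set S) (v : ℕ → S → ℝ) (h : List M.Move) (p : M.Move) : ℝ≥0∞ :=
  if ∃ q ∈ h, q.state ∈ T then 1 else ENNReal.ofReal (v h.length p.state)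

variable {v : ℕ → S → ℝ} {h : List M.Move} {p : M.Move}

theorem stoppedAt_nil : stoppedAt T v [] p = ENNReal.ofReal (v 0 p.state) := if_neg (by simp)

open Classical in
theorem expectNext_stoppedAt (σ : M.Scheduler) (hv : ∀ n, 0 ≤ v n) :
    σ.expectNext (stoppedAt T v) h p = if (∃ q ∈ h, q.state ∈ T) ∨ p.state ∈ T then 1
      else ENNReal.ofReal (M.expect p.state p.action (v (h.length + 1))) := by
  have visited_append : (∃ q ∈ h ++ [p], q.state ∈ T) ↔ (∃ q ∈ h, q.state ∈ T) ∨ p.state ∈ T := by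
    simp [or_and_right, exists_or]
  simp only [Scheduler.expectNext, stoppedAt, visited_append, List.length_append,
    List.length_singleton]
  split_ifs
  · simp only [mul_one]
    exact M.sum_ofReal_P p.2
  · exact M.sum_ofReal_P_mul_ofReal _ _ (hv _)

theorem expectNext_stoppedAt_le {σ : M.Scheduler} (hv : ∀ n, 0 ≤ v n)
    (hT : ∀ n, ∀ s ∈ T, 1 ≤ v n s)
    (hsup : ∀ h, ∀ s ∉ T, M.expect s (σ.act h s) (v (h.length + 1)) ≤ v h.length s)
    (h : List M.Move) (s : S) :
    σ.expectNext (stoppedAt T v) h (σ.move h s) ≤ stoppedAt T v h (σ.move h s) := by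
  simp only [expectNext_stoppedAt σ hv, stoppedAt, Scheduler.state_move, Scheduler.action_move]
  by_cases hh : ∃ q ∈ h, q.state ∈ T
  · simp only [hh, true_or, if_true, le_refl]
  by_cases hs : s ∈ T
  · simpa only [hh, hs, or_true, if_true, if_false] using ENNReal.one_le_ofReal.2 (hT _ s hs)
  · simpa only [hh, hs, or_self, if_false] using ENNReal.ofReal_le_ofReal (hsup h s hs)

theorem stoppedAt_le_expectNext {σ : M.Scheduler} (hv : ∀ n, 0 ≤ v n)
    (hT : ∀ n, ∀ s ∈ T, v n s ≤ 1)
    (hsub : ∀ h, ∀ s ∉ T, v h.length s ≤ M.expect s (σ.act h s) (v (h.length + 1)))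
    (h : List M.Move) (s : S) :
    stoppedAt T v h (σ.move h s) ≤ σ.expectNext (stoppedAt T v) h (σ.move h s) := by
  simp only [expectNext_stoppedAt σ hv, stoppedAt, Scheduler.state_move, Scheduler.action_move]
  by_cases hh : ∃ q ∈ h, q.state ∈ T
  · simp only [hh, true_or, if_true, le_refl]
  by_cases hs : s ∈ T
  · simpa only [hh, hs, or_true, if_true, if_false] using ENNReal.ofReal_le_one.2 (hT _ s hs)
  · simpa only [hh, hs, or_self, if_false] using ENNReal.ofReal_le_ofReal (hsub h s hs)

theorem reach_eq_iUnion (M : MDP S A) (T : Set S) :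
    M.reach T = ⋃ n, {w | ∃ j < n, (w j).state ∈ T} := by
  ext w
  simp only [reach, Set.mem_iUnion, Set.mem_ofPred_eq]
  exact ⟨fun ⟨j, hj⟩ => ⟨j + 1, j, j.lt_succ_self, hj⟩, fun ⟨_, j, _, hj⟩ => ⟨j, hj⟩⟩

theorem measurableSet_exists_lt_state_mem (T : Set S) (n : ℕ) :
    MeasurableSet {w : ℕ → M.Move | ∃ j < n, (w j).state ∈ T} := by
  have hT (j : ℕ) : MeasurableSet {w : ℕ → M.Move | (w j).state ∈ T} :=
    (measurable_pi_apply (X := fun _ => M.Move) j)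
      (MeasurableSet.of_discrete (s := {p : M.Move | p.state ∈ T}))
  simp only [← exists_prop, Set.ofPred_exists]
  exact .iUnion fun j => .iUnion fun _ => hT j

theorem measurableSet_reach (M : MDP S A) (T : Set S) : MeasurableSet (M.reach T) := by
  rw [reach_eq_iUnion]
  exact .iUnion (measurableSet_exists_lt_state_mem T)

variable [Finite A] {σ : M.Scheduler}

theorem tendsto_measure_exists_lt_state_mem (σ : M.Scheduler) (s : S) (T : Set S) :
    Tendsto (fun n => σ.pathMeasure s {w | ∃ j < n, (w j).state ∈ T}) atTop
      (𝓝 (σ.pathMeasure s (M.reach T))) := by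
  rw [reach_eq_iUnion]
  exact tendsto_measure_iUnion_atTop fun m n hmn w ⟨j, hj, h⟩ => ⟨j, hj.trans_le hmn, h⟩

theorem reachProb_le_of_superharmonic {g : S → ℝ} (hg : 0 ≤ g) (hT : ∀ s ∈ T, 1 ≤ g s)
    (hsup : ∀ h, ∀ s ∉ T, M.expect s (σ.act h s) g ≤ g s) (s : S) : M.reachProb σ s T ≤ g s := by
  refine ENNReal.toReal_le_of_le_ofReal (hg s)
    (le_of_tendsto' (tendsto_measure_exists_lt_state_mem σ s T) fun n => ?_)
  let F : List M.Move → M.Move → ℝ≥0∞ := stoppedAt T fun _ => g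
  calc σ.pathMeasure s {w | ∃ j < n, (w j).state ∈ T}
      = ∫⁻ w, {w | ∃ j < n, (w j).state ∈ T}.indicator 1 w ∂σ.pathMeasure s :=
        (lintegral_indicator_one (measurableSet_exists_lt_state_mem T n)).symm
    _ ≤ ∫⁻ w, F (history n w) (w n) ∂σ.pathMeasure s := by
        refine lintegral_mono (Set.indicator_le ?_)
        exact fun w ⟨j, hj, hjT⟩ => (if_pos (exists_mem_history_state_mem.2 ⟨j, hj, hjT⟩)).ge
    _ = σ.expectNext^[n] F [] (σ.move [] s) := lintegral_history σ s n F
    _ ≤ F [] (σ.move [] s) := Scheduler.iterate_expectNext_le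
        (expectNext_stoppedAt_le (fun _ => hg) (fun _ => hT) hsup) n [] s
    _ = ENNReal.ofReal (g s) := stoppedAt_nil

theorem le_reachProb_of_subharmonic (hv : ∀ n, 0 ≤ v n) (hT : ∀ n, ∀ s ∈ T, v n s ≤ 1)
    (hsub : ∀ h, ∀ s ∉ T, v h.length s ≤ M.expect s (σ.act h s) (v (h.length + 1)))
    {n : ℕ} (hn : ∀ s ∉ T, v n s ≤ 0) (s : S) : v 0 s ≤ M.reachProb σ s T := by
  refine (ENNReal.ofReal_le_iff_le_toReal (measure_ne_top _ _)).1 ?_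
  have stoppedAt_le (w : ℕ → M.Move) :
      stoppedAt T v (history n w) (w n) ≤ (M.reach T).indicator 1 w := by
    have indicator_eq {j : ℕ} (hj : (w j).state ∈ T) : (M.reach T).indicator 1 w = (1 : ℝ≥0∞) :=
      Set.indicator_of_mem (s := M.reach T) ⟨j, hj⟩ 1
    rw [stoppedAt, length_history]
    split_ifs with hw
    · obtain ⟨j, -, hj⟩ := exists_mem_history_state_mem.1 hw
      rw [indicator_eq hj]
    by_cases hwn : (w n).state ∈ T
    · rw [indicator_eq hwn]
      exact ENNReal.ofReal_le_one.2 (hT n _ hwn)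
    · rw [ENNReal.ofReal_of_nonpos (hn _ hwn)]
      exact zero_le
  calc ENNReal.ofReal (v 0 s)
      = stoppedAt T v [] (σ.move [] s) := (stoppedAt_nil (p := σ.move [] s)).symm
    _ ≤ σ.expectNext^[n] (stoppedAt T v) [] (σ.move [] s) :=
        Scheduler.le_iterate_expectNext (stoppedAt_le_expectNext hv hT hsub) n [] s
    _ = ∫⁻ w, stoppedAt T v (history n w) (w n) ∂σ.pathMeasure s :=
        (lintegral_history σ s n _).symm
    _ ≤ ∫⁻ w, (M.reach T).indicator 1 w ∂σ.pathMeasure s := lintegral_mono stoppedAt_le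
    _ = σ.pathMeasure s (M.reach T) := lintegral_indicator_one (measurableSet_reach M T)

end Reach

section Bellman

variable {S A : Type*} [Fintype S] [Fintype A] (M : MDP S A)

open Classical in
/-- The finite set of the actions that are enabled in `s`. -/
noncomputable def actFinset (s : S) : Finset A := Finset.univ.filter (· ∈ M.Act s)

theorem mem_actFinset {s : S} {a : A} : a ∈ M.actFinset s ↔ a ∈ M.Act s := by
  simp [actFinset]

theorem actFinset_nonempty (s : S) : (M.actFinset s).Nonempty :=
  (M.exists_enabled s).imp fun _ ha => M.mem_actFinset.2 ha

open Classical in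
/-- The Bellman operator for maximal expectations on `U`, with boundary values `b`. -/
noncomputable def bellman (U : Set S) (b f : S → ℝ) (s : S) : ℝ :=
  if s ∈ U then (M.actFinset s).sup' (M.actFinset_nonempty s) (fun a => M.expect s a f) else b s

variable {M} {U : Set S} {b f g h : S → ℝ} {s : S}

theorem bellman_of_notMem (hs : s ∉ U) : M.bellman U b f s = b s := if_neg hs

theorem expect_le_bellman (hs : s ∈ U) {a : A} (ha : a ∈ M.Act s) :
    M.expect s a f ≤ M.bellman U b f s := by
  rw [bellman, if_pos hs]
  exact Finset.le_sup' (fun a => M.expect s a f) (M.mem_actFinset.2 ha)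

theorem exists_bellman_eq (b f : S → ℝ) (hs : s ∈ U) :
    ∃ a ∈ M.Act s, M.bellman U b f s = M.expect s a f := by
  rw [bellman, if_pos hs]
  obtain ⟨a, ha, h⟩ := Finset.exists_mem_eq_sup' (M.actFinset_nonempty s)
    (fun a => M.expect s a f)
  exact ⟨a, M.mem_actFinset.1 ha, h⟩

theorem exists_greedy_action (M : MDP S A) (U : Set S) (b f : S → ℝ) (s : S) :
    ∃ a ∈ M.Act s, s ∈ U → M.bellman U b f s = M.expect s a f := by
  by_cases hs : s ∈ U
  · exact (exists_bellman_eq b f hs).imp fun _ => And.imp_right fun h _ => h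
  · exact (M.exists_enabled s).imp fun _ ha => ⟨ha, fun h => absurd h hs⟩

theorem bellman_mono : Monotone (M.bellman U b) := by
  intro f g hfg s
  by_cases hs : s ∈ U
  · obtain ⟨a, ha, h⟩ := exists_bellman_eq (M := M) b f hs
    rw [h]
    exact (M.expect_mono hfg).trans (expect_le_bellman hs ha)
  · rw [bellman_of_notMem hs, bellman_of_notMem hs]

theorem bellman_mem_Icc (hb : b ∈ Set.Icc 0 1) (hf : f ∈ Set.Icc 0 1) :
    M.bellman U b f ∈ Set.Icc 0 1 := by
  suffices ∀ s, 0 ≤ M.bellman U b f s ∧ M.bellman U b f s ≤ 1 from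
    ⟨fun s => (this s).1, fun s => (this s).2⟩
  intro s
  by_cases hs : s ∈ U
  · obtain ⟨a, ha, h⟩ := exists_bellman_eq (M := M) b f hs
    rw [h]
    exact ⟨M.expect_nonneg hf.1, (M.expect_mono hf.2).trans (M.expect_const ha 1).le⟩
  · rw [bellman_of_notMem hs]
    exact ⟨hb.1 s, hb.2 s⟩

theorem bellman_add_mul_le {δ : ℝ} (hδ : 0 ≤ δ) :
    M.bellman U b (fun s => f s + h s * δ) s ≤ M.bellman U b f s + M.bellman U 0 h s * δ := by
  by_cases hs : s ∈ U
  · obtain ⟨a, ha, h1⟩ := exists_bellman_eq (M := M) b (fun s => f s + h s * δ) hs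
    rw [h1, expect_add_mul]
    exact add_le_add (expect_le_bellman hs ha)
      (mul_le_mul_of_nonneg_right (expect_le_bellman hs ha) hδ)
  · simp [bellman_of_notMem hs]

theorem iterate_bellman_add_mul_le {δ : ℝ} (hδ : 0 ≤ δ) (n : ℕ) :
    (M.bellman U b)^[n] (fun s => f s + h s * δ) ≤
      fun s => (M.bellman U b)^[n] f s + (M.bellman U 0)^[n] h s * δ := by
  induction n with
  | zero => exact le_rfl
  | succ n ih =>
    simp only [Function.iterate_succ_apply']
    exact (bellman_mono ih).trans fun s => bellman_add_mul_le hδ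

theorem tendsto_bellman {ι : Type*} {l : Filter ι} {F : ι → S → ℝ}
    (hF : Tendsto F l (𝓝 f)) : Tendsto (fun i => M.bellman U b (F i)) l (𝓝 (M.bellman U b f)) := by
  rw [tendsto_pi_nhds] at hF ⊢
  intro s
  by_cases hs : s ∈ U
  · simp only [bellman, if_pos hs]
    exact Tendsto.finset_sup'_nhds_apply _ fun a _ =>
      tendsto_finsetSum _ fun s' _ => (hF s').const_mul _
  · simp only [bellman_of_notMem hs]
    exact tendsto_const_nhds

theorem bellman_eq_of_tendsto_iterate
    (hf : Tendsto (fun n => (M.bellman U b)^[n] g) atTop (𝓝 f)) : M.bellman U b f = f := by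
  refine tendsto_nhds_unique (tendsto_bellman hf) ?_
  simpa only [Function.iterate_succ_apply'] using (tendsto_add_atTop_iff_nat 1).2 hf

end Bellman

section HorizonValue

variable {S A : Type*} [Fintype S] [Fintype A] (M : MDP S A)

open Classical in
/-- The maximal expected reward within `n` steps if `b` is earned on leaving `U`, and `v` for
still being in `U` at the end. -/
noncomputable def horizonValue (U : Set S) (b : S → ℝ) (n : ℕ) (v : ℝ) : S → ℝ :=
  (M.bellman U b)^[n] (U.piecewise (fun _ => v) b)

/-- The maximal probability to stay in `U` for `n` steps. -/
noncomputable def maxStayProb (U : Set S) (n : ℕ) : S → ℝ := M.horizonValue U 0 n 1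

variable {M} {U : Set S} {b V : S → ℝ} {s : S} {v : ℝ} {n : ℕ}

open Classical in
theorem horizonValue_zero_of_mem (hs : s ∈ U) : M.horizonValue U b 0 v s = v :=
  Set.piecewise_eq_of_mem U (fun _ => v) b hs

theorem horizonValue_succ :
    M.horizonValue U b (n + 1) v = M.bellman U b (M.horizonValue U b n v) :=
  Function.iterate_succ_apply' _ _ _

open Classical in
theorem horizonValue_of_notMem (hs : s ∉ U) : M.horizonValue U b n v s = b s := by
  cases n with
  | zero => exact Set.piecewise_eq_of_notMem U (fun _ => v) b hs
  | succ n => rw [horizonValue_succ, bellman_of_notMem hs]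

open Classical in
theorem horizonValue_mem_Icc (hb : b ∈ Set.Icc 0 1) (hv : v ∈ Set.Icc 0 1) :
    M.horizonValue U b n v ∈ Set.Icc 0 1 := by
  induction n with
  | zero => exact Set.piecewise_mem_Icc' (f₁ := fun _ => v) ⟨fun _ => hv.1, fun _ => hv.2⟩ hb
  | succ n ih => exact horizonValue_succ (M := M) ▸ bellman_mem_Icc hb ih

open Classical in
theorem le_horizonValue_of_bellman_eq (hV : M.bellman U b V = V) (hv : ∀ s ∈ U, V s ≤ v) :
    V ≤ M.horizonValue U b n v :=
  (Function.iterate_fixed hV n).ge.trans <| bellman_mono.iterate n <|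
    Set.le_piecewise hv fun s hs => by rw [← hV, bellman_of_notMem hs]

open Classical in
theorem horizonValue_le_of_bellman_eq (hV : M.bellman U b V = V) (hv : ∀ s ∈ U, v ≤ V s) :
    M.horizonValue U b n v ≤ V :=
  (bellman_mono.iterate n <|
    Set.piecewise_le hv fun s hs => by rw [← hV, bellman_of_notMem hs]).trans
      (Function.iterate_fixed hV n).le

open Classical in
theorem monotone_horizonValue_zero (hb : b ∈ Set.Icc 0 1) :
    Monotone fun n => M.horizonValue U b n 0 :=
  bellman_mono.monotone_iterate_of_le_map <| Set.piecewise_le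
    (fun s _ => (horizonValue_mem_Icc (n := 1) hb ⟨le_rfl, zero_le_one⟩).1 s)
    fun _ hs => (bellman_of_notMem hs).ge

theorem maxStayProb_mem_Icc : M.maxStayProb U n ∈ Set.Icc 0 1 :=
  horizonValue_mem_Icc ⟨le_rfl, zero_le_one⟩ ⟨zero_le_one, le_rfl⟩

open Classical in
theorem antitone_maxStayProb : Antitone (M.maxStayProb U) := by
  refine bellman_mono.antitone_iterate_of_map_le (Set.le_piecewise (fun s _ => ?_) fun s hs => ?_)
  · exact (maxStayProb_mem_Icc (n := 1)).2 s
  · exact (bellman_of_notMem hs).le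

theorem exists_tendsto_maxStayProb (M : MDP S A) (U : Set S) :
    ∃ p, Tendsto (M.maxStayProb U) atTop (𝓝 p) :=
  ⟨_, tendsto_pi_nhds.2 fun s => tendsto_atTop_ciInf (fun _ _ h => antitone_maxStayProb h s)
    ⟨0, fun _ ⟨_, h⟩ => h ▸ maxStayProb_mem_Icc.1 s⟩⟩

theorem tendsto_maxStayProb (hM : M.IsContracting Uᶜ) :
    Tendsto (M.maxStayProb U) atTop (𝓝 0) := by
  obtain ⟨p, hp⟩ := exists_tendsto_maxStayProb M U
  have bellman_p : M.bellman U 0 p = p := bellman_eq_of_tendsto_iterate hp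
  have p_nonneg : 0 ≤ p := ge_of_tendsto' hp fun n => maxStayProb_mem_Icc.1
  have p_le_one : p ≤ 1 := le_of_tendsto' hp fun n => maxStayProb_mem_Icc.2
  choose a ha greedy using M.exists_greedy_action U 0 p
  let σ : M.Scheduler := ⟨fun _ => a, fun _ => ha⟩
  have reachProb_le (s : S) : M.reachProb σ s Uᶜ ≤ 1 - p s := by
    refine reachProb_le_of_superharmonic (g := fun s => 1 - p s)
      (fun s => sub_nonneg.2 (p_le_one s)) (fun s hs => ?_) (fun _ s hs => ?_) s
    · rw [← bellman_p, bellman_of_notMem hs, Pi.zero_apply, sub_zero]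
    · have := M.expect_add_mul s (a s) (fun _ => 1) p (-1)
      rw [M.expect_const (ha s), ← greedy s (not_not.1 hs), bellman_p] at this
      simpa only [mul_neg_one, ← sub_eq_add_neg] using this.le
  suffices p = 0 by rwa [← this]
  exact le_antisymm (fun s => show p s ≤ 0 by linarith [reachProb_le s, hM s σ]) p_nonneg

/-- Any bounded error on `U` is damped by the probability to stay in `U`, which vanishes. -/
theorem le_of_le_horizonValue (hV : M.bellman U b V = V)
    (hstay : Tendsto (M.maxStayProb U) atTop (𝓝 0)) (hn : 0 < n)
    (hv : ∀ s ∈ U, v ≤ M.horizonValue U b n v s) : ∀ s ∈ U, v ≤ V s := by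
  classical
  intro s hs
  set f : S → ℝ := U.piecewise (fun _ => v) b
  set c : ℝ := ∑ s, |v - V s|
  have f_le_iterate : f ≤ (M.bellman U b)^[n] f :=
    Set.piecewise_le hv fun s hs => (horizonValue_of_notMem hs).ge
  have f_le : f ≤ fun s => V s + U.piecewise (fun _ => (1 : ℝ)) 0 s * c := by
    refine Set.piecewise_le (fun s hs => ?_) fun s hs => ?_
    · rw [Set.piecewise_eq_of_mem _ _ _ hs, one_mul, ← sub_le_iff_le_add']
      exact (le_abs_self _).trans
        (Finset.single_le_sum (f := fun s => |v - V s|) (fun _ _ => abs_nonneg _)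
          (Finset.mem_univ s))
    · rw [Set.piecewise_eq_of_notMem _ _ _ hs, ← hV, bellman_of_notMem hs]
      simp
  have le_add (k : ℕ) : v ≤ V s + M.maxStayProb U (n * k) s * c := calc
    v = f s := (Set.piecewise_eq_of_mem U (fun _ => v) b hs).symm
    _ ≤ (M.bellman U b)^[n * k] f s := by
      rw [Function.iterate_mul]
      exact (bellman_mono.iterate n).monotone_iterate_of_le_map f_le_iterate k.zero_le s
    _ ≤ (M.bellman U b)^[n * k] V s + M.maxStayProb U (n * k) s * c :=
      (bellman_mono.iterate _ f_le).trans
        (iterate_bellman_add_mul_le (Finset.sum_nonneg fun _ _ => abs_nonneg _) _) s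
    _ = V s + M.maxStayProb U (n * k) s * c := by rw [Function.iterate_fixed hV]
  have hlim : Tendsto (fun k => V s + M.maxStayProb U (n * k) s * c) atTop (𝓝 (V s + 0 * c)) :=
    tendsto_const_nhds.add <| ((tendsto_pi_nhds.1 hstay s).comp
      (tendsto_id.const_mul_atTop' hn)).mul_const c
  simpa using ge_of_tendsto' hlim le_add

end HorizonValue

section MaxReach

theorem indicator_one_mem_Icc {S : Type*} {G : Set S} :
    G.indicator (1 : S → ℝ) ∈ Set.Icc 0 1 :=
  ⟨Set.indicator_nonneg fun _ _ => zero_le_one, Set.indicator_le_self' fun _ _ => zero_le_one⟩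

variable {S A : Type*} [Fintype S] {M : MDP S A} {G : Set S} {s : S}

instance : Nonempty M.Scheduler :=
  ⟨⟨fun _ s => (M.exists_enabled s).choose, fun _ s => (M.exists_enabled s).choose_spec⟩⟩

section Finite

variable [Finite A]

theorem bddAbove_range_reachProb (M : MDP S A) (G : Set S) (s : S) :
    BddAbove (Set.range fun σ : M.Scheduler => M.reachProb σ s G) :=
  ⟨1, fun _ ⟨_, h⟩ => h ▸ measureReal_le_one⟩

theorem maxReachProb_le_of_superharmonic {g : S → ℝ} (hg : 0 ≤ g) (hG : ∀ s ∈ G, 1 ≤ g s)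
    (hsup : ∀ s ∉ G, ∀ a ∈ M.Act s, M.expect s a g ≤ g s) (s : S) : M.maxReachProb s G ≤ g s :=
  ciSup_le fun σ =>
    reachProb_le_of_superharmonic hg hG (fun h s hs => hsup s hs _ (σ.enabled h s)) s

theorem maxReachProb_nonneg (s : S) : 0 ≤ M.maxReachProb s G :=
  Real.iSup_nonneg fun _ => measureReal_nonneg

theorem maxReachProb_le_one (s : S) : M.maxReachProb s G ≤ 1 := ciSup_le fun _ => measureReal_le_one

theorem maxReachProb_of_mem (hs : s ∈ G) : M.maxReachProb s G = 1 := by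
  obtain ⟨σ⟩ : Nonempty M.Scheduler := inferInstance
  refine le_antisymm (maxReachProb_le_one s) (le_ciSup_of_le (bddAbove_range_reachProb M G s) σ ?_)
  have indicator_of_notMem (t : S) (ht : t ∉ G) : G.indicator (1 : S → ℝ) t = 0 :=
    Set.indicator_of_notMem ht 1
  have indicator_le := le_reachProb_of_subharmonic (σ := σ) (v := fun _ => G.indicator 1) (n := 0)
    (fun _ => indicator_one_mem_Icc.1) (fun _ t _ => indicator_one_mem_Icc.2 t)
    (fun _ t ht => (indicator_of_notMem t ht).trans_le (M.expect_nonneg indicator_one_mem_Icc.1))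
    (fun t ht => (indicator_of_notMem t ht).le) s
  rwa [Set.indicator_of_mem hs, Pi.one_apply] at indicator_le

end Finite

variable [Fintype A]

/-- Value iteration from below: `M.horizonValue Gᶜ (G.indicator 1) n 0` are the maximal
probabilities to reach `G` within `n` steps. -/
theorem horizonValue_le_maxReachProb (n : ℕ) (s : S) :
    M.horizonValue Gᶜ (G.indicator 1) n 0 s ≤ M.maxReachProb s G := by
  set v : ℕ → S → ℝ := fun k => M.horizonValue Gᶜ (G.indicator 1) (n - k) 0
  have v_mem (k : ℕ) : v k ∈ Set.Icc 0 1 :=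
    horizonValue_mem_Icc indicator_one_mem_Icc ⟨le_rfl, zero_le_one⟩
  choose a ha greedy using fun k => M.exists_greedy_action Gᶜ (G.indicator 1) (v (k + 1))
  let σ : M.Scheduler := ⟨fun h => a h.length, fun h => ha h.length⟩
  refine le_trans ?_ (le_ciSup (bddAbove_range_reachProb M G s) σ)
  refine le_reachProb_of_subharmonic (v := v) (n := n) (fun k => (v_mem k).1)
    (fun k s _ => (v_mem k).2 s) (fun h s hs => ?_) (fun s hs => ?_) s
  · rcases lt_or_ge h.length n with hn | hn
    · rw [← greedy h.length s hs, ← horizonValue_succ,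
        show n - (h.length + 1) + 1 = n - h.length by omega]
    · refine (le_of_eq ?_).trans (M.expect_nonneg (v_mem _).1)
      simp only [v, Nat.sub_eq_zero_of_le hn]
      exact horizonValue_zero_of_mem hs
  · simp only [v, Nat.sub_self]
    exact (horizonValue_zero_of_mem hs).le

theorem bellman_compl_maxReachProb :
    M.bellman Gᶜ (G.indicator 1) (fun s => M.maxReachProb s G) = fun s => M.maxReachProb s G := by
  let W (s : S) : ℝ := ⨆ n, M.horizonValue Gᶜ (G.indicator 1) n 0 s
  have mem_Icc (n : ℕ) : M.horizonValue Gᶜ (G.indicator 1) n 0 ∈ Set.Icc 0 1 :=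
    horizonValue_mem_Icc indicator_one_mem_Icc ⟨le_rfl, zero_le_one⟩
  have tendsto_W : Tendsto (fun n => M.horizonValue Gᶜ (G.indicator 1) n 0) atTop (𝓝 W) :=
    tendsto_pi_nhds.2 fun s => tendsto_atTop_ciSup
      (fun _ _ h => monotone_horizonValue_zero indicator_one_mem_Icc h s)
      ⟨1, fun _ ⟨n, h⟩ => h ▸ (mem_Icc n).2 s⟩
  have bellman_W : M.bellman Gᶜ (G.indicator 1) W = W := bellman_eq_of_tendsto_iterate tendsto_W
  suffices W = fun s => M.maxReachProb s G by rwa [← this]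
  refine funext fun s => le_antisymm (ciSup_le fun n => horizonValue_le_maxReachProb n s) ?_
  refine maxReachProb_le_of_superharmonic (ge_of_tendsto' tendsto_W fun n => (mem_Icc n).1)
    (fun s hs => ?_) (fun s hs a ha => ?_) s
  · rw [← bellman_W, bellman_of_notMem (not_not.2 hs), Set.indicator_of_mem hs, Pi.one_apply]
  · exact (expect_le_bellman hs ha).trans (congrFun bellman_W s).le

theorem coe_unknownStates (M : MDP S A) (G : Set S) :
    (M.unknownStates G : Set S) = (G ∪ M.zeroStates G)ᶜ := by
  ext s
  simp [unknownStates, and_comm]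

theorem notMem_of_mem_unknownStates (hs : s ∈ M.unknownStates G) : s ∉ G := by
  rw [← Finset.mem_coe, coe_unknownStates] at hs
  exact fun h => hs (.inl h)

theorem maxReachProb_of_notMem_unknownStates (hs : s ∉ M.unknownStates G) :
    M.maxReachProb s G = G.indicator 1 s := by
  rw [← Finset.mem_coe, coe_unknownStates, Set.notMem_compl_iff] at hs
  by_cases hsG : s ∈ G
  · rw [maxReachProb_of_mem hsG, Set.indicator_of_mem hsG, Pi.one_apply]
  · rw [Set.indicator_of_notMem hsG]
    exact hs.resolve_left hsG

theorem bellman_unknownStates_maxReachProb :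
    M.bellman (M.unknownStates G) (G.indicator 1) (fun s => M.maxReachProb s G) =
      fun s => M.maxReachProb s G := by
  funext s
  by_cases hs : s ∈ M.unknownStates G
  · have hsG : s ∈ Gᶜ := notMem_of_mem_unknownStates hs
    rw [← congrFun bellman_compl_maxReachProb s, bellman, bellman, if_pos (Finset.mem_coe.2 hs),
      if_pos hsG]
  · rw [bellman_of_notMem (Finset.mem_coe.not.2 hs), maxReachProb_of_notMem_unknownStates hs]

theorem tendsto_maxStayProb_unknownStates (hM : M.IsContracting (G ∪ M.zeroStates G)) :
    Tendsto (M.maxStayProb (M.unknownStates G)) atTop (𝓝 0) :=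
  tendsto_maxStayProb (by rwa [coe_unknownStates, compl_compl])

end MaxReach

section Actions

variable {S A : Type*} [Fintype S] {M : MDP S A} {x y : S → ℝ} {s : S} {a : A}

theorem argmax_nonempty {A : Type*} [Finite A] {T : Set A} (hT : T.Nonempty) (f : A → ℝ) :
    (argmax T f).Nonempty :=
  Set.exists_max_image T f T.toFinite hT

theorem findAction_nonempty [Finite A] (M : MDP S A) (x y : S → ℝ) (s : S) (u : EReal) :
    (M.findAction x y s u).Nonempty := by
  unfold findAction
  split_ifs
  · exact argmax_nonempty (M.exists_enabled s) _
  · exact argmax_nonempty (argmax_nonempty (M.exists_enabled s) _) _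

theorem mem_Act_of_mem_findAction {u : EReal} (ha : a ∈ M.findAction x y s u) : a ∈ M.Act s := by
  unfold findAction at ha
  split_ifs at ha
  · exact ha.1
  · exact ha.1.1

theorem findAction_coe (M : MDP S A) (x y : S → ℝ) (s : S) (u : ℝ) :
    M.findAction x y s u = argmax (M.Act s) fun a => M.expect s a x + M.expect s a y * u := by
  simp only [findAction, if_pos (EReal.coe_ne_top u), EReal.toReal_coe, expect_add_mul]

theorem findAction_top (M : MDP S A) (x y : S → ℝ) (s : S) :
    M.findAction x y s ⊤ =
      argmax (argmax (M.Act s) fun a => M.expect s a y) fun a => M.expect s a x :=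
  if_neg (not_not.2 rfl)

variable [Fintype A]

theorem decisionValue_le_iff {c : EReal} :
    M.decisionValue x y s a ≤ c ↔ ∀ b ∈ M.Act s, M.expect s b y < M.expect s a y →
      (((M.expect s b x - M.expect s a x) / (M.expect s a y - M.expect s b y) : ℝ) : EReal) ≤
        c := by
  have sum_sub (a b : A) (z : S → ℝ) :
      ∑ s', (M.P s a s' - M.P s b s') * z s' = M.expect s a z - M.expect s b z := by
    simp only [expect, sub_mul, Finset.sum_sub_distrib]
  simp only [decisionValue, sum_sub, Finset.sup_le_iff, Finset.mem_filter, Finset.mem_univ,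
    true_and, sub_pos]
  refine forall_congr' fun b => ⟨fun h hb hlt => h ⟨hb, ?_, hlt⟩, fun h hb => h hb.1 hb.2.2⟩
  rintro rfl
  exact lt_irrefl _ hlt

theorem decisionValue_le_coe_iff {v : ℝ} :
    M.decisionValue x y s a ≤ v ↔ ∀ b ∈ M.Act s, M.expect s b y < M.expect s a y →
      M.expect s b x + M.expect s b y * v ≤ M.expect s a x + M.expect s a y * v := by
  refine decisionValue_le_iff.trans <| forall₂_congr fun b _ => forall_congr' fun hlt => ?_
  rw [EReal.coe_le_coe_iff, div_le_iff₀ (sub_pos.2 hlt)]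
  constructor <;> intro h <;> linarith

theorem decisionValue_lt_top : M.decisionValue x y s a < ⊤ := by
  unfold decisionValue
  exact (Finset.sup_lt_iff bot_lt_top).2 fun b _ => EReal.coe_lt_top _

theorem decisionValue_le_of_mem_findAction {u : EReal} (hu : u ≠ ⊥)
    (ha : a ∈ M.findAction x y s u) : M.decisionValue x y s a ≤ u := by
  induction u with
  | bot => exact absurd rfl hu
  | top => exact le_top
  | coe u =>
    rw [findAction_coe] at ha
    exact decisionValue_le_coe_iff.2 fun b hb _ => ha.2 b hb

/-- Lowering `v` from `u` favours the actions with a smaller expectation of `y`, and these take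
over only below the decision value. -/
theorem expect_le_of_mem_findAction {u : EReal} {v : ℝ} (ha : a ∈ M.findAction x y s u)
    (hd : M.decisionValue x y s a ≤ v) (hv : (v : EReal) ≤ u) {b : A} (hb : b ∈ M.Act s) :
    M.expect s b (fun s' => x s' + y s' * v) ≤ M.expect s a (fun s' => x s' + y s' * v) := by
  rw [expect_add_mul, expect_add_mul]
  rcases lt_or_ge (M.expect s b y) (M.expect s a y) with hlt | hge
  · exact decisionValue_le_coe_iff.1 hd b hb hlt
  induction u with
  | bot => exact absurd hv (EReal.bot_lt_coe v).not_ge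
  | top =>
    rw [findAction_top] at ha
    have y_eq : M.expect s a y = M.expect s b y := le_antisymm hge (ha.1.2 b hb)
    rw [y_eq]
    exact add_le_add_left (ha.2 b ⟨hb, fun c hc => (ha.1.2 c hc).trans y_eq.le⟩) _
  | coe u =>
    rw [findAction_coe] at ha
    have optimal_at_u := ha.2 b hb
    have slope := mul_le_mul_of_nonneg_left (EReal.coe_le_coe_iff.1 hv) (sub_nonneg.2 hge)
    linarith

end Actions

section Iterate

variable {S A : Type*} [Fintype S] [Fintype A] {M : MDP S A} {G : Set S} {s : S} {v : ℝ}

theorem initVars_x (M : MDP S A) (G : Set S) : (M.initVars G).x = G.indicator 1 := by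
  classical
  funext s
  simp [initVars, Set.indicator_apply]

theorem initVars_y (M : MDP S A) (G : Set S) :
    (M.initVars G).y = M.maxStayProb (M.unknownStates G) 0 := by
  classical
  funext s
  simp [initVars, maxStayProb, horizonValue, Set.indicator_apply]

theorem initVars_add_mul (M : MDP S A) (G : Set S) (v : ℝ) (s : S) :
    (M.initVars G).x s + (M.initVars G).y s * v =
      M.horizonValue (M.unknownStates G) (G.indicator 1) 0 v s := by
  classical
  by_cases hs : s ∈ M.unknownStates G
  · simp [initVars, hs, notMem_of_mem_unknownStates hs, horizonValue_zero_of_mem]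
  · simp [initVars, hs, horizonValue_of_notMem, Set.indicator_apply]

variable {c : Vars S} {α : S → A}

theorem iterate_x (M : MDP S A) (G : Set S) (c : Vars S) (α : S → A) :
    (M.iterate G c α).x = M.updateX G c.x α := by
  simp only [iterate]
  split_ifs <;> rfl

theorem iterate_y (M : MDP S A) (G : Set S) (c : Vars S) (α : S → A) :
    (M.iterate G c α).y = M.updateY G c.y α := by
  simp only [iterate]
  split_ifs <;> rfl

theorem iterate_d (M : MDP S A) (G : Set S) (c : Vars S) (α : S → A) :
    (M.iterate G c α).d = M.updateD G c α := by
  simp only [iterate]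
  split_ifs <;> rfl

/-- The quotient `x[s] / (1 - y[s])`, the solution `v` of `x[s] + y[s] · v = v`, from which the
algorithm computes its bounds. -/
noncomputable def ratio (c : Vars S) (s : S) : ℝ := c.x s / (1 - c.y s)

open Classical in
theorem iterate_l (M : MDP S A) (G : Set S) (c : Vars S) (α : S → A) :
    (M.iterate G c α).l = if ∀ s ∈ M.unknownStates G, (M.iterate G c α).y s < 1 then
      max c.l ((M.unknownStates G).inf fun s => (ratio (M.iterate G c α) s : EReal)) else c.l := by
  simp only [ratio, iterate_x, iterate_y]
  simp only [iterate]
  split_ifs <;> rfl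

open Classical in
theorem iterate_u (M : MDP S A) (G : Set S) (c : Vars S) (α : S → A) :
    (M.iterate G c α).u = if ∀ s ∈ M.unknownStates G, (M.iterate G c α).y s < 1 then
      min c.u (max (M.iterate G c α).d
        ((M.unknownStates G).sup fun s => (ratio (M.iterate G c α) s : EReal))) else c.u := by
  simp only [ratio, iterate_x, iterate_y, iterate_d]
  simp only [iterate]
  split_ifs <;> rfl

theorem le_iterate_l (M : MDP S A) (G : Set S) (c : Vars S) (α : S → A) :
    c.l ≤ (M.iterate G c α).l := by
  rw [iterate_l]
  split_ifs
  exacts [le_max_left _ _, le_rfl]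

theorem iterate_u_le (M : MDP S A) (G : Set S) (c : Vars S) (α : S → A) :
    (M.iterate G c α).u ≤ c.u := by
  rw [iterate_u]
  split_ifs
  exacts [min_le_left _ _, le_rfl]

theorem le_iterate_d (M : MDP S A) (G : Set S) (c : Vars S) (α : S → A) :
    c.d ≤ (M.iterate G c α).d := by
  rw [iterate_d]
  exact le_max_left _ _

theorem decisionValue_le_iterate_d (hs : s ∈ M.unknownStates G) :
    M.decisionValue c.x c.y s (α s) ≤ (M.iterate G c α).d := by
  rw [iterate_d]
  exact (Finset.le_sup (f := fun s => M.decisionValue c.x c.y s (α s)) hs).trans (le_max_right _ _)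

theorem iterate_d_lt_top (hd : c.d < ⊤) : (M.iterate G c α).d < ⊤ := by
  rw [iterate_d]
  exact max_lt hd ((Finset.sup_lt_iff bot_lt_top).2 fun _ _ => decisionValue_lt_top)

theorem iterate_x_of_notMem (hs : s ∉ M.unknownStates G) :
    (M.iterate G c α).x s = G.indicator 1 s := by
  classical
  rw [iterate_x, updateX, if_neg hs, Set.indicator_apply, Pi.one_apply]

theorem iterate_y_of_mem (hs : s ∈ M.unknownStates G) :
    (M.iterate G c α).y s = M.expect s (α s) c.y := by
  rw [iterate_y, updateY, if_pos hs]

theorem iterate_y_of_notMem (hs : s ∉ M.unknownStates G) : (M.iterate G c α).y s = 0 := by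
  rw [iterate_y, updateY, if_neg hs]

theorem iterate_y_nonneg (hy : 0 ≤ c.y) : 0 ≤ (M.iterate G c α).y := by
  intro s
  by_cases hs : s ∈ M.unknownStates G
  · rw [iterate_y_of_mem hs]
    exact M.expect_nonneg hy
  · rw [iterate_y_of_notMem hs, Pi.zero_apply]

theorem iterate_add_mul_of_mem (hs : s ∈ M.unknownStates G) :
    (M.iterate G c α).x s + (M.iterate G c α).y s * v =
      M.expect s (α s) fun s' => c.x s' + c.y s' * v := by
  rw [iterate_y_of_mem hs, expect_add_mul, iterate_x, updateX,
    if_neg (notMem_of_mem_unknownStates hs), if_pos hs]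

theorem iterate_add_mul_of_notMem (hs : s ∉ M.unknownStates G) :
    (M.iterate G c α).x s + (M.iterate G c α).y s * v = G.indicator 1 s := by
  rw [iterate_x_of_notMem hs, iterate_y_of_notMem hs, zero_mul, add_zero]

end Iterate

section Invariant

variable {S A : Type*} [Fintype S] [Fintype A] {M : MDP S A} {G : Set S} {s : S} {v : ℝ}

/-- The loop invariant after `k` iterations. The vectors `x` and `y` are generated by the actions
that are optimal for the horizon `k` and every final value `v ∈ [d, u]`, and `l` and `u` bound
the maximal reachability probabilities on `S_?`. -/
structure Invariant (M : MDP S A) (G : Set S) (k : ℕ) (c : Vars S) : Prop where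
  x_of_notMem : ∀ s ∉ M.unknownStates G, c.x s = G.indicator 1 s
  y_nonneg : 0 ≤ c.y
  y_le : c.y ≤ M.maxStayProb (M.unknownStates G) k
  le_horizonValue : ∀ v s,
    c.x s + c.y s * v ≤ M.horizonValue (M.unknownStates G) (G.indicator 1) k v s
  horizonValue_le : ∀ v : ℝ, c.d ≤ v → v ≤ c.u → ∀ s,
    M.horizonValue (M.unknownStates G) (G.indicator 1) k v s ≤ c.x s + c.y s * v
  d_le_u : c.d ≤ c.u
  d_lt_top : c.d < ⊤
  le_u : ∀ s ∈ M.unknownStates G, (M.maxReachProb s G : EReal) ≤ c.u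
  l_le : ∀ s ∈ M.unknownStates G, c.l ≤ M.maxReachProb s G

theorem invariant_initVars : M.Invariant G 0 (M.initVars G) where
  x_of_notMem s _ := by rw [initVars_x]
  y_nonneg := by
    rw [initVars_y]
    exact maxStayProb_mem_Icc.1
  y_le := (initVars_y M G).le
  le_horizonValue v s := (initVars_add_mul M G v s).le
  horizonValue_le v _ _ s := (initVars_add_mul M G v s).ge
  d_le_u := bot_le
  d_lt_top := bot_lt_top
  le_u _ _ := le_top
  l_le _ _ := bot_le

variable {k : ℕ} {c : Vars S}

namespace Invariant

theorem add_mul_le_maxReachProb (hc : M.Invariant G k c)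
    (hv : ∀ s ∈ M.unknownStates G, v ≤ M.maxReachProb s G) (s : S) :
    c.x s + c.y s * v ≤ M.maxReachProb s G :=
  (hc.le_horizonValue v s).trans
    (horizonValue_le_of_bellman_eq bellman_unknownStates_maxReachProb hv s)

theorem maxReachProb_le_add_mul (hc : M.Invariant G k c) (hd : c.d ≤ v) (hu : v ≤ c.u)
    (hv : ∀ s ∈ M.unknownStates G, M.maxReachProb s G ≤ v) (s : S) :
    M.maxReachProb s G ≤ c.x s + c.y s * v :=
  (le_horizonValue_of_bellman_eq bellman_unknownStates_maxReachProb hv s).trans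
    (hc.horizonValue_le v hd hu s)

theorem u_ne_bot (hc : M.Invariant G k c) (hs : s ∈ M.unknownStates G) : c.u ≠ ⊥ :=
  ((EReal.bot_lt_coe _).trans_le (hc.le_u s hs)).ne'

theorem exists_real_maxReachProb_le (hc : M.Invariant G k c) (hs : s ∈ M.unknownStates G) :
    ∃ v : ℝ, c.d ≤ v ∧ v ≤ c.u ∧ ∀ t ∈ M.unknownStates G, M.maxReachProb t G ≤ v := by
  have d_le_u := hc.d_le_u
  have u_ne_bot := hc.u_ne_bot hs
  have le_u := hc.le_u
  generalize c.u = u at *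
  induction u with
  | bot => exact absurd rfl u_ne_bot
  | coe u => exact ⟨u, d_le_u, le_rfl, fun t ht => EReal.coe_le_coe_iff.1 (le_u t ht)⟩
  | top =>
    refine ⟨max c.d.toReal 1, ?_, le_top, fun t _ =>
      (maxReachProb_le_one t).trans (le_max_right _ _)⟩
    exact (EReal.le_coe_toReal hc.d_lt_top.ne).trans (EReal.coe_le_coe_iff.2 (le_max_left _ _))

theorem x_eq_of_y_eq_zero (hc : M.Invariant G k c) (hy : c.y s = 0) :
    c.x s = M.maxReachProb s G := by
  by_cases hs : s ∈ M.unknownStates G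
  · obtain ⟨v, hd, hu, hv⟩ := hc.exists_real_maxReachProb_le hs
    have hle := hc.add_mul_le_maxReachProb (fun t _ => maxReachProb_nonneg t) s
    have hge := hc.maxReachProb_le_add_mul hd hu hv s
    rw [hy, zero_mul, add_zero] at hle hge
    exact le_antisymm hle hge
  · rw [hc.x_of_notMem s hs, maxReachProb_of_notMem_unknownStates hs]

theorem y_of_notMem (hc : M.Invariant G k c) (hs : s ∉ M.unknownStates G) : c.y s = 0 :=
  le_antisymm ((hc.y_le s).trans_eq (horizonValue_of_notMem hs)) (hc.y_nonneg s)

variable {α : S → A}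

theorem iterate_y_le_maxStayProb (hc : M.Invariant G k c)
    (hα : ∀ s ∈ M.unknownStates G, α s ∈ M.Act s) :
    (M.iterate G c α).y ≤ M.maxStayProb (M.unknownStates G) (k + 1) := by
  intro s
  by_cases hs : s ∈ M.unknownStates G
  · rw [iterate_y_of_mem hs, maxStayProb, horizonValue_succ]
    exact (M.expect_mono hc.y_le).trans (expect_le_bellman hs (hα s hs))
  · rw [iterate_y_of_notMem hs]
    exact maxStayProb_mem_Icc.1 s

theorem iterate_le_horizonValue (hc : M.Invariant G k c)
    (hα : ∀ s ∈ M.unknownStates G, α s ∈ M.Act s) (v : ℝ) (s : S) :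
    (M.iterate G c α).x s + (M.iterate G c α).y s * v ≤
      M.horizonValue (M.unknownStates G) (G.indicator 1) (k + 1) v s := by
  by_cases hs : s ∈ M.unknownStates G
  · rw [iterate_add_mul_of_mem hs, horizonValue_succ]
    exact (M.expect_mono (hc.le_horizonValue v)).trans (expect_le_bellman hs (hα s hs))
  · rw [iterate_add_mul_of_notMem hs, horizonValue_of_notMem (Finset.mem_coe.not.2 hs)]

theorem horizonValue_le_iterate (hc : M.Invariant G k c)
    (hα : ∀ s ∈ M.unknownStates G, α s ∈ M.findAction c.x c.y s c.u)
    (hd : (M.iterate G c α).d ≤ v) (hv : v ≤ c.u) (s : S) :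
    M.horizonValue (M.unknownStates G) (G.indicator 1) (k + 1) v s ≤
      (M.iterate G c α).x s + (M.iterate G c α).y s * v := by
  by_cases hs : s ∈ M.unknownStates G
  · rw [iterate_add_mul_of_mem hs, horizonValue_succ]
    obtain ⟨b, hb, bellman_eq⟩ := exists_bellman_eq (M := M) (G.indicator 1)
      (M.horizonValue (M.unknownStates G) (G.indicator 1) k v) (Finset.mem_coe.2 hs)
    rw [bellman_eq]
    exact (M.expect_mono (hc.horizonValue_le v ((le_iterate_d M G c α).trans hd) hv)).trans
      (expect_le_of_mem_findAction (hα s hs) ((decisionValue_le_iterate_d hs).trans hd) hv hb)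
  · rw [iterate_add_mul_of_notMem hs, horizonValue_of_notMem (Finset.mem_coe.not.2 hs)]

theorem iterate_d_le (hc : M.Invariant G k c)
    (hα : ∀ s ∈ M.unknownStates G, α s ∈ M.findAction c.x c.y s c.u) :
    (M.iterate G c α).d ≤ c.u := by
  rw [iterate_d]
  exact max_le hc.d_le_u <| Finset.sup_le fun s hs =>
    decisionValue_le_of_mem_findAction (hc.u_ne_bot hs) (hα s hs)

theorem iterate_d_le_iterate_u (hc : M.Invariant G k c)
    (hα : ∀ s ∈ M.unknownStates G, α s ∈ M.findAction c.x c.y s c.u) :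
    (M.iterate G c α).d ≤ (M.iterate G c α).u := by
  rw [iterate_u]
  split_ifs
  · exact le_min (hc.iterate_d_le hα) (le_max_left _ _)
  · exact hc.iterate_d_le hα

/-- If the largest probability `V` on `S_?`, attained at `t`, is at least `d`, then
`V ≤ x[t] + y[t] · V`, so that it is at most the quotient at `t`. -/
theorem maxReachProb_le_iterate_u (hc : M.Invariant G k c)
    (hα : ∀ s ∈ M.unknownStates G, α s ∈ M.findAction c.x c.y s c.u)
    (hs : s ∈ M.unknownStates G) : M.maxReachProb s G ≤ (M.iterate G c α).u := by
  rw [iterate_u]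
  split_ifs with hy
  swap
  · exact hc.le_u s hs
  refine le_min (hc.le_u s hs) ?_
  obtain ⟨t, ht, hmax⟩ := Finset.exists_max_image (M.unknownStates G)
    (fun s => M.maxReachProb s G) ⟨s, hs⟩
  refine (EReal.coe_le_coe_iff.2 (hmax s hs)).trans ?_
  rcases le_total (M.iterate G c α).d (M.maxReachProb t G) with hd | hd
  · have hle : M.maxReachProb t G ≤ ratio (M.iterate G c α) t := by
      have := (le_horizonValue_of_bellman_eq bellman_unknownStates_maxReachProb hmax t).trans
        (hc.horizonValue_le_iterate hα hd (hc.le_u t ht) t)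
      rw [ratio, le_div_iff₀ (sub_pos.2 (hy t ht))]
      linarith
    exact ((EReal.coe_le_coe_iff.2 hle).trans (Finset.le_sup
      (f := fun s => (ratio (M.iterate G c α) s : EReal)) ht)).trans (le_max_right _ _)
  · exact hd.trans (le_max_left _ _)

theorem iterate_l_le_maxReachProb (hM : M.IsContracting (G ∪ M.zeroStates G))
    (hc : M.Invariant G k c) (hα : ∀ s ∈ M.unknownStates G, α s ∈ M.Act s)
    (hs : s ∈ M.unknownStates G) : (M.iterate G c α).l ≤ M.maxReachProb s G := by
  rw [iterate_l]
  split_ifs with hy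
  swap
  · exact hc.l_le s hs
  refine max_le (hc.l_le s hs) ?_
  obtain ⟨t, ht, hmin⟩ := Finset.exists_min_image (M.unknownStates G)
    (ratio (M.iterate G c α)) ⟨s, hs⟩
  refine (Finset.inf_le ht).trans (EReal.coe_le_coe_iff.2 ?_)
  refine le_of_le_horizonValue bellman_unknownStates_maxReachProb
    (tendsto_maxStayProb_unknownStates hM) k.succ_pos (fun r hr => ?_) s hs
  refine le_trans ?_ (hc.iterate_le_horizonValue hα _ r)
  have := hmin r hr
  nth_rw 2 [ratio] at this
  rw [le_div_iff₀ (sub_pos.2 (hy r hr))] at this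
  linarith

theorem of_body (hM : M.IsContracting (G ∪ M.zeroStates G)) (hc : M.Invariant G k c)
    {c' : Vars S} (h : M.Body G c c') : M.Invariant G (k + 1) c' := by
  obtain ⟨α, hα, rfl⟩ := h
  have hact (s : S) (hs : s ∈ M.unknownStates G) : α s ∈ M.Act s :=
    mem_Act_of_mem_findAction (hα s hs)
  exact {
    x_of_notMem := fun _ => iterate_x_of_notMem
    y_nonneg := iterate_y_nonneg hc.y_nonneg
    y_le := hc.iterate_y_le_maxStayProb hact
    le_horizonValue := hc.iterate_le_horizonValue hact
    horizonValue_le := fun _ hd hu =>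
      hc.horizonValue_le_iterate hα hd (hu.trans (iterate_u_le M G c α))
    d_le_u := hc.iterate_d_le_iterate_u hα
    d_lt_top := iterate_d_lt_top hc.d_lt_top
    le_u := fun _ => hc.maxReachProb_le_iterate_u hα
    l_le := fun _ => hc.iterate_l_le_maxReachProb hM hact }

end Invariant

end Invariant

section Correctness

variable {S A : Type*} [Fintype S] {M : MDP S A} {c : Vars S} {ε : ℝ}

theorem exitCond_of_le {l u : ℝ} (hy : 0 ≤ c.y M.init) (hl : l ≤ c.l) (hu : c.u ≤ u)
    (h : c.y M.init * (u - l) < 2 * ε) : M.ExitCond ε c := calc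
  (c.y M.init : EReal) * (c.u - c.l)
    ≤ c.y M.init * (u - l) :=
      mul_le_mul_of_nonneg_left (EReal.sub_le_sub hu hl) (EReal.coe_nonneg.2 hy)
  _ < (2 * ε : ℝ) := by exact_mod_cast h

theorem ExitCond.exists_real (h : M.ExitCond ε c) (hy : 0 < c.y M.init) (hl : c.l ≠ ⊤)
    (hu : c.u ≠ ⊥) : ∃ l u : ℝ, c.l = l ∧ c.u = u := by
  rw [ExitCond] at h
  generalize c.l = l, c.u = u at *
  induction l with
  | top => exact absurd rfl hl
  | bot =>
    rw [EReal.sub_bot hu, EReal.coe_mul_top_of_pos hy] at h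
    exact absurd h not_top_lt
  | coe l =>
    induction u with
    | bot => exact absurd rfl hu
    | top =>
      rw [EReal.top_sub_coe, EReal.coe_mul_top_of_pos hy] at h
      exact absurd h not_top_lt
    | coe u => exact ⟨l, u, rfl, rfl⟩

theorem output_of_y_eq_zero (hy : c.y M.init = 0) : M.output c = c.x M.init := by
  rw [output, hy, EReal.coe_zero, zero_mul, add_zero]

variable [Fintype A] {G : Set S} {k : ℕ}

theorem Invariant.exists_output_eq (hc : M.Invariant G k c) (hε : 0 ≤ ε) (h : M.ExitCond ε c) :
    ∃ r : ℝ, M.output c = r ∧ |r - M.maxReachProb M.init G| ≤ ε := by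
  by_cases hy : c.y M.init = 0
  · refine ⟨_, output_of_y_eq_zero hy, ?_⟩
    rwa [hc.x_eq_of_y_eq_zero hy, sub_self, abs_zero]
  have hs : M.init ∈ M.unknownStates G := not_not.1 fun hs => hy (hc.y_of_notMem hs)
  obtain ⟨l, u, hl, hu⟩ := h.exists_real ((hc.y_nonneg _).lt_of_ne' hy)
    ((hc.l_le _ hs).trans_lt (EReal.coe_lt_top _)).ne (hc.u_ne_bot hs)
  have l_le (s : S) (hs : s ∈ M.unknownStates G) : l ≤ M.maxReachProb s G :=
    EReal.coe_le_coe_iff.1 (hl ▸ hc.l_le s hs)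
  have le_u (s : S) (hs : s ∈ M.unknownStates G) : M.maxReachProb s G ≤ u :=
    EReal.coe_le_coe_iff.1 (hu ▸ hc.le_u s hs)
  have lower := hc.add_mul_le_maxReachProb l_le M.init
  have upper := hc.maxReachProb_le_add_mul (hu ▸ hc.d_le_u) hu.ge le_u M.init
  have width : c.y M.init * (u - l) < 2 * ε := by
    rw [ExitCond, hl, hu] at h
    exact_mod_cast h
  refine ⟨c.x M.init + c.y M.init * ((l + u) / 2), ?_, ?_⟩
  · rw [output, hl, hu]
    norm_cast
  · rw [abs_le]
    constructor <;> linarith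

theorem bot_lt_iterate_l {α : S → A} (hy : ∀ s, (M.iterate G c α).y s < 1) :
    ⊥ < (M.iterate G c α).l := by
  rw [iterate_l, if_pos fun s _ => hy s]
  exact lt_max_of_lt_right ((Finset.lt_inf_iff bot_lt_top).2 fun _ _ => EReal.bot_lt_coe _)

theorem iterate_u_lt_top {α : S → A} (hd : c.d < ⊤) (hy : ∀ s, (M.iterate G c α).y s < 1) :
    (M.iterate G c α).u < ⊤ := by
  rw [iterate_u, if_pos fun s _ => hy s]
  exact min_lt_of_right_lt <| max_lt (iterate_d_lt_top hd) <|
    (Finset.sup_lt_iff bot_lt_top).2 fun _ _ => EReal.coe_lt_top _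

theorem exists_exitCond (hM : M.IsContracting (G ∪ M.zeroStates G)) (hε : 0 < ε)
    {C : ℕ → Vars S} (h0 : C 0 = M.initVars G) (hC : ∀ n, M.Body G (C n) (C (n + 1))) :
    ∃ n, M.ExitCond ε (C (n + 1)) := by
  have hinv (n : ℕ) : M.Invariant G n (C n) := by
    induction n with
    | zero => exact h0 ▸ invariant_initVars
    | succ n ih => exact ih.of_body hM (hC n)
  have tendsto_y (s : S) : Tendsto (fun n => (C (n + 1)).y s) atTop (𝓝 0) :=
    (tendsto_add_atTop_iff_nat 1).2 <| squeeze_zero (fun n => (hinv n).y_nonneg s)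
      (fun n => (hinv n).y_le s) (tendsto_pi_nhds.1 (tendsto_maxStayProb_unknownStates hM) s)
  choose α _ hC using hC
  have mono_l : Monotone fun n => (C n).l :=
    monotone_nat_of_le_succ fun n => hC n ▸ le_iterate_l M G (C n) (α n)
  have anti_u : Antitone fun n => (C n).u :=
    antitone_nat_of_succ_le fun n => hC n ▸ iterate_u_le M G (C n) (α n)
  obtain ⟨N, hN⟩ : ∃ N, ∀ s, (C (N + 1)).y s < 1 :=
    (eventually_all.2 fun s => (tendsto_y s).eventually_lt_const zero_lt_one).exists
  rw [hC] at hN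
  obtain ⟨l, -, hl⟩ := EReal.lt_iff_exists_real_btwn.1 (bot_lt_iterate_l hN)
  obtain ⟨u, hu, -⟩ := EReal.lt_iff_exists_real_btwn.1 (iterate_u_lt_top (hinv N).d_lt_top hN)
  rw [← hC] at hl hu
  have tendsto_width : Tendsto (fun n => (C (n + 1)).y M.init * (u - l)) atTop (𝓝 0) := by
    simpa only [zero_mul] using (tendsto_y M.init).mul_const (u - l)
  obtain ⟨n, hNn, hn⟩ := ((eventually_ge_atTop N).and
    (tendsto_width.eventually_lt_const (mul_pos two_pos hε))).exists
  exact ⟨n, exitCond_of_le ((hinv _).y_nonneg _) (hl.le.trans (mono_l (Nat.succ_le_succ hNn)))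
    ((anti_u (Nat.succ_le_succ hNn)).trans hu.le) hn⟩

theorem Step.exists_eq_running {f f' : Config S} (h : M.Step G ε f f') :
    ∃ c, f = Config.running c := by
  cases h <;> exact ⟨_, rfl⟩

theorem step_running_running_iff {c c' : Vars S} :
    M.Step G ε (Config.running c) (Config.running c') ↔ M.Body G c c' ∧ ¬ M.ExitCond ε c' :=
  ⟨fun | .loop _ _ hb hx => ⟨hb, hx⟩, fun h => .loop c c' h.1 h.2⟩

theorem exists_step (M : MDP S A) (G : Set S) (ε : ℝ) (c : Vars S) :
    ∃ f, M.Step G ε (Config.running c) f := by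
  choose α hα using fun s => M.findAction_nonempty c.x c.y s c.u
  have hbody : M.Body G c (M.iterate G c α) := ⟨α, fun s _ => hα s, rfl⟩
  by_cases hx : M.ExitCond ε (M.iterate G c α)
  · exact ⟨_, .exit c _ hbody hx⟩
  · exact ⟨_, .loop c _ hbody hx⟩

theorem not_exists_infinite_run (hM : M.IsContracting (G ∪ M.zeroStates G)) (hε : 0 < ε) :
    ¬ ∃ e : ℕ → Config S, e 0 = Config.running (M.initVars G) ∧
      ∀ n, M.Step G ε (e n) (e (n + 1)) := by
  rintro ⟨e, h0, hstep⟩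
  choose C hC using fun n => (hstep n).exists_eq_running
  simp only [hC, step_running_running_iff] at hstep
  have hC0 : C 0 = M.initVars G := Config.running.inj ((hC 0).symm.trans h0)
  obtain ⟨n, hn⟩ := exists_exitCond hM hε hC0 fun n => (hstep n).1
  exact (hstep n).2 hn

theorem invariant_or_returned_of_reachable (hM : M.IsContracting (G ∪ M.zeroStates G))
    (hε : 0 ≤ ε) {f : Config S}
    (h : Relation.ReflTransGen (M.Step G ε) (Config.running (M.initVars G)) f) :
    (∃ k c, f = Config.running c ∧ M.Invariant G k c) ∨
      ∃ r : ℝ, f = Config.returned r ∧ |r - M.maxReachProb M.init G| ≤ ε := by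
  induction h with
  | refl => exact .inl ⟨0, _, rfl, invariant_initVars⟩
  | tail _ hstep ih =>
    obtain ⟨k, c, rfl, hc⟩ | ⟨r, rfl, -⟩ := ih
    · cases hstep with
      | loop _ c' hbody _ => exact .inl ⟨k + 1, c', rfl, hc.of_body hM hbody⟩
      | exit _ c' hbody hx =>
        obtain ⟨r, hr, hle⟩ := (hc.of_body hM hbody).exists_output_eq hε hx
        exact .inr ⟨r, congrArg _ hr, hle⟩
    · exact absurd hstep.exists_eq_running (by simp)

end Correctness

end MDP

theorem theorem5_general {S A : Type*} [Fintype S] [Fintype A] (M : MDP S A) (G : Set S)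
    (hM : M.IsContracting (G ∪ M.zeroStates G)) (ε : ℝ) (hε : 0 < ε) :
    (¬ ∃ e : ℕ → MDP.Config S, e 0 = MDP.Config.running (M.initVars G) ∧
      ∀ n, M.Step G ε (e n) (e (n + 1))) ∧
    ∀ f : MDP.Config S,
      Relation.ReflTransGen (M.Step G ε) (MDP.Config.running (M.initVars G)) f →
      (¬ ∃ f', M.Step G ε f f') →
      ∃ r : ℝ, f = MDP.Config.returned (r : EReal) ∧ |r - M.maxReachProb M.init G| ≤ ε := by
  refine ⟨MDP.not_exists_infinite_run hM hε, fun f hreach hstuck => ?_⟩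
  obtain ⟨_, c, rfl, -⟩ | hreturned := MDP.invariant_or_returned_of_reachable hM hε.le hreach
  · exact absurd (MDP.exists_step M G ε c) hstuck
  · exact hreturned

theorem theorem5 {S A : Type*} [Fintype S] [Fintype A] (M : MDP S A) (G : Set S)
    (hG : ∀ s ∈ G, M.IsAbsorbing s) (hM : M.IsContracting (G ∪ M.zeroStates G))
    (ε : ℝ) (hε : 0 < ε) :
    (¬ ∃ e : ℕ → MDP.Config S, e 0 = MDP.Config.running (M.initVars G) ∧
      ∀ n, M.Step G ε (e n) (e (n + 1))) ∧
    ∀ f : MDP.Config S,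
      Relation.ReflTransGen (M.Step G ε) (MDP.Config.running (M.initVars G)) f →
      (¬ ∃ f', M.Step G ε f f') →
      ∃ r : ℝ, f = MDP.Config.returned (r : EReal) ∧ |r - M.maxReachProb M.init G| ≤ ε :=
  theorem5_general M G hM ε hε
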